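/- For a finite group $G$ and a positive integer $k$ let $L_k(G)=\{x\in G : x^k=1\}$ and $\mathbf{b}_k(G)=|L_k(G)|/k$, and let $\mathbf{B}(G)=\max\{\mathbf{b}_k(G) : k \text{ divides } |G|\}$ be the global breadth of $G$. Let $q$ be a prime power, let $\mathbb{F}_q$ be a field with $q$ elements, and let $\mathrm{PSL}(2,q)=\mathrm{SL}(2,\mathbb{F}_q)/Z(\mathrm{SL}(2,\mathbb{F}_q))$. (i) If $q$ is odd and $q\ge 5$, then $\mathbf{B}(\mathrm{PSL}(2,q))=\frac{q(q-1)}{2}-2$, and the maximum is attained at $k=\frac{q-1}{2}$, that is, $\frac{q-1}{2}$ divides $|\mathrm{PSL}(2,q)|$ and $\mathbf{b}_{(q-1)/2}(\mathrm{PSL}(2,q))=\mathbf{B}(\mathrm{PSL}(2,q))$. (ii) If $q=2^m$ with $m\ge 2$, then $\mathbf{B}(\mathrm{PSL}(2,q))=2^{2m-1}$, and the maximum is attained at $k=2$, that is, $2$ divides $|\mathrm{PSL}(2,q)|$ and $\mathbf{b}_2(\mathrm{PSL}(2,q))=\mathbf{B}(\mathrm{PSL}(2,q))$. -/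

import Mathlib

/-- The set `L_k(G)` of the solutions in `G` of the equation `x ^ k = 1`. -/
def solutionSet (G : Type*) [Group G] (k : ℕ) : Set G := {x : G | x ^ k = 1}

/-- The local breadth `b_k(G) = |L_k(G)| / k`, with exact (rational) division. -/
noncomputable def localBreadth (G : Type*) [Group G] (k : ℕ) : ℚ :=
  ((solutionSet G k).ncard : ℚ) / (k : ℚ)

/-- The global breadth `B(G)` of a finite group: the maximum of the local breadths `b_k(G)`
over all divisors `k` of the order of `G`. -/
noncomputable def globalBreadth (G : Type*) [Group G] [Finite G] : ℚ :=
  (Nat.card G).divisors.sup' (Nat.nonempty_divisors.mpr Nat.card_pos.ne') (localBreadth G)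

/-- The group `PSL(2, F) = SL(2, F) / Z(SL(2, F))` over a field `F`. -/
abbrev PSL2 (F : Type*) [Field F] : Type _ := Matrix.ProjectiveSpecialLinearGroup (Fin 2) F

/-! Everything is counted in SL(2,q), trace by trace. Let e be the order of the center (`signCard`).
A matrix killed by e is central, so e·|L_k(PSL)| is the number of M in SL(2,q) with M^n = 1, where n
= ek (`signCard_mul_ncard_solutionSet`).

By `card_trace_eq` a trace t is taken by q(q-1) + qr matrices, where r = 0, 1, 2 is the number of
roots of x² - tx + 1 in F. If M^n = 1, the eigenvalues are n-th roots of unity, and also (q-1)-th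
ones when r = 2 and (q+1)-th ones when r = 0. So at most (gcd(n, q∓1) - e)/2 such traces occur. The
case r = 1 gives at most eq² matrices if the characteristic divides n, and at most e otherwise. The
sum is `two_mul_card_pow_eq_one_le`.

The gcds of k with the two torus orders in PSL are coprime, so their product is at most k, with a
further factor p when p ∣ k. The upper bound thus becomes a polynomial inequality. It is attained
for odd q by the split and central elements (`card_split_le`), and for even q by the matrices of
trace 0 (`card_sq_le_of_two_eq_zero`). -/

open Finset Matrix MatrixGroups

/-! ### Matrices of determinant 1 with given trace -/

section TraceCount

variable {F : Type*} [Field F] [Fintype F] [DecidableEq F]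

/-- The roots in `F` of the characteristic polynomial `x ^ 2 - t x + 1`. -/
def traceRoots (t : F) : Finset F := univ.filter fun x => x * x + 1 = t * x

theorem mem_traceRoots {t x : F} : x ∈ traceRoots t ↔ x * x + 1 = t * x := by
  simp [traceRoots]

/-- The roots of `x ^ 2 - t x + 1` are `x` and `x⁻¹` as soon as `x` is one of them. -/
theorem traceRoots_eq_pair {t x : F} (hx : x ∈ traceRoots t) : traceRoots t = {x, x⁻¹} := by
  rw [mem_traceRoots] at hx
  have hx0 : x ≠ 0 := by
    rintro rfl
    simp at hx
  ext y
  rw [mem_traceRoots, mem_insert, mem_singleton]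
  have key : y * y + 1 = t * y ↔ (y - x) * (y * x - 1) = 0 := by
    have h : x * (y * y + 1 - t * y) = (y - x) * (y * x - 1) := by linear_combination y * hx
    rw [← h, mul_eq_zero, or_iff_right hx0, sub_eq_zero]
  rw [key, mul_eq_zero, sub_eq_zero, sub_eq_zero, ← one_div, eq_div_iff hx0]

theorem card_prod_mul_eq (c : F) :
    #{p : F × F | p.1 * p.2 = c} =
      (Fintype.card F - 1) + if c = 0 then Fintype.card F else 0 := by
  have h1 : #{p : F × F | p.1 * p.2 = c} = ∑ y : F, #{z : F | y * z = c} := by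
    simp only [card_filter, Fintype.sum_prod_type]
  rw [h1, ← Finset.add_sum_erase _ _ (mem_univ (0 : F)), add_comm]
  congr 1
  · rw [Finset.sum_congr rfl (g := fun _ => 1)]
    · simp
    · intro y hy
      have hy0 : y ≠ 0 := ne_of_mem_erase hy
      rw [card_eq_one]
      refine ⟨y⁻¹ * c, ?_⟩
      ext z
      simp only [mem_filter, mem_univ, true_and, mem_singleton]
      rw [eq_inv_mul_iff_mul_eq₀ hy0]
  · by_cases hc : c = 0
    · simp [hc]
    · simp [hc, eq_comm (a := (0 : F))]

/-- The number of matrices in `SL(2, F)` with a given trace. -/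
theorem card_trace_eq (t : F) :
    #{M : SL(2, F) | M 0 0 + M 1 1 = t} =
      Fintype.card F * (Fintype.card F - 1) + Fintype.card F * #(traceRoots t) := by
  rw [card_eq_sum_card_fiberwise (f := fun M => M 0 0) (t := univ) (fun _ _ => mem_univ _)]
  -- Once M 0 0 = x, the other diagonal entry is t - x and the off-diagonal entries have product x(t
  -- - x) - 1, which is 0 exactly at the roots.
  have h : ∀ x : F, #{M ∈ ({M : SL(2, F) | M 0 0 + M 1 1 = t} : Finset _) | M 0 0 = x} =
      (Fintype.card F - 1) + if x * x + 1 = t * x then Fintype.card F else 0 := by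
    intro x
    have hc := card_prod_mul_eq (x * (t - x) - 1)
    have hiff : x * (t - x) - 1 = 0 ↔ x * x + 1 = t * x :=
      ⟨fun h => by linear_combination -h, fun h => by linear_combination -h⟩
    simp only [hiff] at hc
    rw [← hc]
    refine card_bij' (fun M _ => (M 0 1, M 1 0))
      (fun p hp => ⟨!![x, p.1; p.2, t - x], by
        rw [det_fin_two_of]
        rw [mem_filter] at hp
        linear_combination -hp.2⟩) ?_ ?_ ?_ ?_
    · intro M hM
      simp only [mem_filter, mem_univ, true_and] at hM ⊢
      have hdet := M.det_coe
      rw [det_fin_two] at hdet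
      obtain ⟨h1, h2⟩ := hM
      have h3 : M 1 1 = t - x := by rw [← h1, h2]; ring
      rw [← h3, ← h2]
      linear_combination -hdet
    · intro p hp
      exact mem_filter.2 ⟨mem_filter.2 ⟨mem_univ _, add_sub_cancel x t⟩, rfl⟩
    · intro M hM
      simp only [mem_filter, mem_univ, true_and] at hM
      obtain ⟨h1, h2⟩ := hM
      ext i j
      fin_cases i <;> fin_cases j <;> simp [← h1, ← h2]
    · intro p hp
      simp
  simp only [h, sum_add_distrib, ← sum_filter]
  simp [traceRoots, mul_comm]

end TraceCount

/-! ### Powers and eigenvalues of 2×2 matrices -/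

section CayleyHamilton

variable {F : Type*} [Field F]

theorem sq_eq_of_det_eq_one {A : Matrix (Fin 2) (Fin 2) F} (hA : A.det = 1) :
    A ^ 2 = (A 0 0 + A 1 1) • A - 1 := by
  rw [det_fin_two] at hA
  rw [sq]
  ext i j
  fin_cases i <;> fin_cases j <;> simp [Matrix.mul_apply, Fin.sum_univ_two] <;>
    first | ring1 | linear_combination (-1 : F) * hA

theorem mulVec_pow_of_mulVec {n : Type*} [Fintype n] [DecidableEq n] {R : Type*} [CommRing R]
    {A : Matrix n n R} {v : n → R} {x : R} (h : A *ᵥ v = x • v) (k : ℕ) :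
    (A ^ k) *ᵥ v = x ^ k • v := by
  induction k with
  | zero => simp
  | succ k ih => rw [pow_succ, ← mulVec_mulVec, h, mulVec_smul, ih, smul_smul, pow_succ']

/-- An eigenvalue, in an extension field, of a matrix `A` with `A ^ n = 1` and `det A = 1` is an
`n`-th root of unity. -/
theorem eigenvalue_pow_eq_one {K : Type*} [Field K] [Algebra F K]
    {A : Matrix (Fin 2) (Fin 2) F} (hA : A.det = 1) {n : ℕ} (hn : A ^ n = 1) {x : K}
    (hx : x * x + 1 = algebraMap F K (A 0 0 + A 1 1) * x) :
    x ^ n = 1 := by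
  classical
  set B : Matrix (Fin 2) (Fin 2) K := A.map (algebraMap F K) with hB
  have hdet : A 0 0 * A 1 1 - A 0 1 * A 1 0 = 1 := by
    rw [← det_fin_two, hA]
  have hdet' := congrArg (algebraMap F K) hdet
  simp only [map_sub, map_mul, map_one, map_add] at hdet' hx
  have h0 : (B - x • (1 : Matrix (Fin 2) (Fin 2) K)).det = 0 := by
    rw [det_fin_two]
    simp [hB]
    linear_combination hx + hdet'
  obtain ⟨v, hv0, hv⟩ := exists_mulVec_eq_zero_iff.mpr h0
  rw [sub_mulVec, smul_mulVec, one_mulVec, sub_eq_zero] at hv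
  have hBn : B ^ n = 1 := by
    rw [hB, ← RingHom.mapMatrix_apply, ← map_pow, hn, map_one]
  have := mulVec_pow_of_mulVec hv n
  rw [hBn, one_mulVec] at this
  by_contra hne
  apply hv0
  have h2 : (x ^ n - 1) • v = 0 := by rw [sub_smul, ← this, one_smul, sub_self]
  exact (smul_eq_zero.mp h2).resolve_left (sub_ne_zero.mpr hne)

/-- If the characteristic polynomial of `A` has the double root `x`, then either `A` is scalar or
the order of `A` is divisible by the characteristic. -/
theorem eq_scalar_of_pow_eq_one {A : Matrix (Fin 2) (Fin 2) F} (hA : A.det = 1) {n : ℕ}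
    (hn : (n : F) ≠ 0) (hAn : A ^ n = 1) {x : F} (hx : x * x = 1) (ht : A 0 0 + A 1 1 = 2 * x) :
    A = x • 1 := by
  -- As x² = 1, the matrix xA has the double eigenvalue 1, so N² = 0 and (xA)^k = 1 + kN; at k = n
  -- this forces nN = 0.
  set N : Matrix (Fin 2) (Fin 2) F := x • A - 1 with hN
  have hsq : A ^ 2 = (2 * x) • A - 1 := by rw [← ht]; exact sq_eq_of_det_eq_one hA
  have hNN : N * N = 0 := by
    have : N * N = (x * x) • (A ^ 2) - (2 * x) • A + 1 := by
      rw [hN, sub_mul, mul_sub, mul_sub, smul_mul_smul_comm, sq, two_mul, add_smul]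
      simp only [mul_one, one_mul]
      abel
    rw [this, hx, hsq, one_smul]
    abel
  have hpow : ∀ k : ℕ, (x • A) ^ k = 1 + (k : F) • N := by
    intro k
    have h1 : x • A = 1 + N := by rw [hN]; abel
    induction k with
    | zero => simp
    | succ k ih =>
      rw [pow_succ, ih, h1, mul_add, mul_one, add_mul, one_mul, smul_mul_assoc, hNN, smul_zero,
        add_zero, Nat.cast_succ, add_smul, one_smul, add_assoc]
  have hxn : x ^ n = 1 := by
    apply eigenvalue_pow_eq_one (K := F) hA hAn
    simp only [Algebra.algebraMap_self, RingHom.id_apply]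
    rw [ht]
    linear_combination -hx
  have h2 := hpow n
  rw [smul_pow, hxn, hAn, one_smul, left_eq_add] at h2
  have h3 : N = 0 := (smul_eq_zero.mp h2).resolve_left hn
  rw [hN, sub_eq_zero] at h3
  rw [← h3, smul_smul, hx, one_smul]

/-- A matrix whose characteristic polynomial has two different roots in `F` is killed by
`q - 1`. -/
theorem pow_card_sub_one_eq_one [Fintype F] {A : Matrix (Fin 2) (Fin 2) F} (hA : A.det = 1) {x : F}
    (hx : x * x ≠ 1) (ht : x * x + 1 = (A 0 0 + A 1 1) * x) : A ^ (Fintype.card F - 1) = 1 := by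
  have hx0 : x ≠ 0 := by
    rintro rfl
    simp at ht
  have hxx : x - x⁻¹ ≠ 0 := by
    intro h
    apply hx
    field_simp at h
    linear_combination h
  have htr : A 0 0 + A 1 1 = x + x⁻¹ := by
    field_simp
    linear_combination -ht
  have hsq : A ^ 2 = (x + x⁻¹) • A - 1 := by rw [← htr]; exact sq_eq_of_det_eq_one hA
  -- Closed form of the Cayley–Hamilton recurrence, with the denominator x - x⁻¹ cleared. At k = q -
  -- 1 the coefficient of A vanishes.
  have hpow : ∀ k : ℕ, (x - x⁻¹) • A ^ k =
      (x ^ k - x⁻¹ ^ k) • A - (x⁻¹ * x ^ k - x * x⁻¹ ^ k) • (1 : Matrix (Fin 2) (Fin 2) F) := by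
    intro k
    induction k with
    | zero =>
      simp only [pow_zero, mul_one, sub_self, zero_smul, zero_sub, ← neg_smul]
      congr 1
      ring
    | succ k ih =>
      rw [pow_succ, ← smul_mul_assoc, ih, sub_mul, smul_mul_assoc, smul_mul_assoc, ← sq, hsq,
        one_mul]
      rw [smul_sub, smul_smul]
      have e1 : x * x⁻¹ = 1 := mul_inv_cancel₀ hx0
      rw [sub_right_comm, ← sub_smul]
      congr 2
      · ring
      · rw [pow_succ, pow_succ]
        linear_combination (-(x ^ k - x⁻¹ ^ k)) * e1
  have hq : x ^ (Fintype.card F - 1) = 1 := FiniteField.pow_card_sub_one_eq_one x hx0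
  have h := hpow (Fintype.card F - 1)
  rw [inv_pow, hq, inv_one, sub_self, zero_smul, zero_sub, ← neg_smul] at h
  apply smul_right_injective _ hxx
  simp only
  rw [h]
  congr 1
  ring

theorem coe_pow_eq_one {M : SL(2, F)} {n : ℕ} (h : M ^ n = 1) :
    (M : Matrix (Fin 2) (Fin 2) F) ^ n = 1 := 
  (Matrix.SpecialLinearGroup.coe_pow M n).symm.trans (by rw [h]; rfl)

theorem pow_eq_one_of_mul_self [Fintype F] {x : F} (hx : x * x = 1) :
    x ^ (Fintype.card F - 1) = 1 ∧ x ^ (Fintype.card F + 1) = 1 := by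
  have hx0 : x ≠ 0 := by
    rintro rfl
    simp at hx
  exact ⟨FiniteField.pow_card_sub_one_eq_one x hx0, by rw [pow_succ, FiniteField.pow_card, hx]⟩

end CayleyHamilton

/-! ### Upper bound for the solutions of M^n = 1 -/

section UpperBound

/-- If the elements of `T` are of the form `x + x⁻¹` where `x ≠ x⁻¹` is a `g`-th root of unity,
then `T` has at most `(g - e) / 2` elements, where `e` is the number of square roots of `1`. -/
theorem two_mul_card_add_le {F Ω : Type*} [Field F] [Fintype F] [DecidableEq F] [Field Ω]
    [Algebra F Ω] {T : Finset F} {g : ℕ} (hg : 0 < g) (h1 : ∀ x : F, x * x = 1 → x ^ g = 1)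
    (hT : ∀ t ∈ T, ∃ x : Ω, x * x + 1 = algebraMap F Ω t * x ∧ x * x ≠ 1 ∧ x ^ g = 1) :
    2 * #T + #{x : F | x * x = 1} ≤ g := by
  classical
  have hinj : Function.Injective (algebraMap F Ω) := (algebraMap F Ω).injective
  set R := Polynomial.nthRootsFinset g (1 : Ω) with hR
  have hRg : #R ≤ g := by
    rw [hR, Polynomial.nthRootsFinset_def]
    exact (Multiset.toFinset_card_le _).trans (Polynomial.card_nthRoots g 1)
  have hV : #{x : F | x * x = 1} ≤ #{x ∈ R | x * x = 1} := by
    refine card_le_card_of_injOn (algebraMap F Ω) ?_ hinj.injOn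
    intro x hx
    have hx : x * x = 1 := by simpa using hx
    rw [mem_coe, mem_filter, hR, Polynomial.mem_nthRootsFinset hg]
    rw [← map_pow, h1 x hx, ← map_mul, hx, map_one]
    exact ⟨rfl, rfl⟩
  -- Each t comes from two distinct g-th roots of unity x and x⁻¹, both different from the square
  -- roots of 1 counted in `hV`.
  have hU : 2 * #(T.image (algebraMap F Ω)) ≤
      #{x ∈ {x ∈ R | x * x ≠ 1} | x + x⁻¹ ∈ T.image (algebraMap F Ω)} := by
    refine mul_card_image_le_card_of_maps_to (f := fun x => x + x⁻¹) ?_ 2 ?_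
    · intro x hx
      exact (mem_filter.1 hx).2
    · intro b hb
      obtain ⟨t, ht, rfl⟩ := mem_image.1 hb
      obtain ⟨x, hx, hxx, hxg⟩ := hT t ht
      have hx0 : x ≠ 0 := by
        rintro rfl
        simp at hx
      have hne : x ≠ x⁻¹ := fun h => hxx (by rw [mul_eq_one_iff_eq_inv₀ hx0]; exact h)
      have hsum : x + x⁻¹ = algebraMap F Ω t := by
        field_simp
        linear_combination hx
      rw [← card_pair hne]
      apply card_le_card
      intro y hy
      rw [mem_insert, mem_singleton] at hy
      simp only [mem_filter, hR, Polynomial.mem_nthRootsFinset hg]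
      rcases hy with rfl | rfl
      · exact ⟨⟨⟨hxg, hxx⟩, by rw [hsum]; exact hb⟩, hsum⟩
      · refine ⟨⟨⟨by rw [inv_pow, hxg, inv_one], ?_⟩, ?_⟩, ?_⟩
        · rw [← mul_inv]
          exact fun h => hxx (inv_eq_one.1 h)
        · rw [inv_inv, add_comm, hsum]
          exact hb
        · rw [inv_inv, add_comm, hsum]
  rw [card_image_of_injective _ hinj] at hU
  have hU2 : 2 * #T ≤ #{x ∈ R | ¬x * x = 1} := hU.trans (card_filter_le _ _)
  have hsum := card_filter_add_card_filter_not (s := R) (fun x => x * x = 1)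
  omega

variable {F : Type*} [Field F] [Fintype F] [DecidableEq F]

theorem card_traceRoots_le_two (t : F) : #(traceRoots t) ≤ 2 := by
  rcases (traceRoots t).eq_empty_or_nonempty with h | ⟨x, hx⟩
  · simp [h]
  · rw [traceRoots_eq_pair hx]
    exact card_le_two

theorem exists_of_card_traceRoots_eq_two {t : F} (h : #(traceRoots t) = 2) :
    ∃ x : F, x * x + 1 = t * x ∧ x * x ≠ 1 := by
  obtain ⟨x, hx⟩ := card_pos.1 (by omega : 0 < #(traceRoots t))
  refine ⟨x, mem_traceRoots.1 hx, fun hxx => ?_⟩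
  rw [traceRoots_eq_pair hx, ← eq_inv_of_mul_eq_one_left hxx] at h
  simp at h

theorem exists_of_card_traceRoots_eq_one {t : F} (h : #(traceRoots t) = 1) :
    ∃ x : F, x * x = 1 ∧ t = 2 * x := by
  obtain ⟨x, hx⟩ := card_pos.1 (by omega : 0 < #(traceRoots t))
  have hx1 := mem_traceRoots.1 hx
  have hxx : x = x⁻¹ := by
    by_contra hne
    rw [traceRoots_eq_pair hx, card_pair hne] at h
    omega
  have hx0 : x ≠ 0 := by
    rintro rfl
    simp at hx1
  have hxx : x * x = 1 := (mul_eq_one_iff_eq_inv₀ hx0).2 hxx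
  exact ⟨x, hxx, by linear_combination (-t) * hxx - x * hx1 + x * hxx⟩

/-- Frobenius maps a root x to a root, hence to x or x⁻¹. It cannot fix x, which lies outside F, so
x^q = x⁻¹. -/
theorem exists_of_card_traceRoots_eq_zero {t : F} (h : #(traceRoots t) = 0) :
    ∃ x : AlgebraicClosure F, x * x + 1 = algebraMap F _ t * x ∧ x * x ≠ 1 ∧
      x ^ (Fintype.card F + 1) = 1 := by
  set φ := algebraMap F (AlgebraicClosure F)
  obtain ⟨x, hx⟩ := IsAlgClosed.exists_root
    (Polynomial.X ^ 2 - Polynomial.C (φ t) * Polynomial.X + 1 :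
      Polynomial (AlgebraicClosure F)) (by
        have : (Polynomial.X ^ 2 - Polynomial.C (φ t) * Polynomial.X + 1 :
          Polynomial (AlgebraicClosure F)).degree = 2 := by compute_degree!
        rw [this]
        decide)
  have hx1 : x * x + 1 = φ t * x := by
    simp [Polynomial.IsRoot] at hx
    linear_combination hx
  have hnot : ∀ y : F, φ y ≠ x := by
    rintro y rfl
    have : y ∈ traceRoots t := by
      rw [mem_traceRoots]
      apply φ.injective
      simpa using hx1
    rw [card_eq_zero] at h
    simp [h] at this
  refine ⟨x, hx1, fun hxx => ?_, ?_⟩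
  · rcases mul_self_eq_one_iff.1 hxx with rfl | rfl
    · exact hnot 1 (map_one _)
    · exact hnot (-1) (by simp)
  · have hfrob : x ^ Fintype.card F * x ^ Fintype.card F + 1 = φ t * x ^ Fintype.card F := by
      have h2 := congrArg (FiniteField.frobeniusAlgHom F (AlgebraicClosure F)) hx1
      simp only [map_add, map_mul, map_one, AlgHom.commutes, φ] at h2
      simpa using h2
    -- Otherwise x and the q elements of F would be q + 1 roots of X^q - X.
    have hne : x ^ Fintype.card F ≠ x := by
      intro hxq
      classical
      have hp0 := FiniteField.X_pow_card_sub_X_ne_zero (AlgebraicClosure F)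
        (Fintype.one_lt_card (α := F))
      have hsub : insert x (univ.image φ) ⊆ (Polynomial.X ^ Fintype.card F - Polynomial.X :
          Polynomial (AlgebraicClosure F)).roots.toFinset := by
        intro y hy
        rw [Multiset.mem_toFinset, Polynomial.mem_roots hp0]
        rcases mem_insert.1 hy with rfl | hy
        · simp [Polynomial.IsRoot, hxq]
        · obtain ⟨z, -, rfl⟩ := mem_image.1 hy
          simp [Polynomial.IsRoot, ← map_pow, FiniteField.pow_card]
      have hle := (card_le_card hsub).trans
        ((Multiset.toFinset_card_le _).trans (Polynomial.card_roots' _))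
      rw [FiniteField.X_pow_card_sub_X_natDegree_eq _ Fintype.one_lt_card, card_insert_of_notMem
        (by simpa using hnot), card_image_of_injective _ φ.injective, card_univ] at hle
      omega
    have hx0 : x ≠ 0 := by
      rintro rfl
      simp at hx1
    have h3 : (x ^ Fintype.card F - x) * (x ^ Fintype.card F * x - 1) = 0 := by
      linear_combination x * hfrob - x ^ Fintype.card F * hx1
    rw [pow_succ]
    exact sub_eq_zero.1 ((mul_eq_zero.1 h3).resolve_left (sub_ne_zero.2 hne))

variable (F) in
/-- The number of square roots of `1` in `F`, which is the order of the center of `SL(2, F)`. -/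
def signCard : ℕ := #{x : F | x * x = 1}

/-- Reduces counting matrices to counting traces, since the size of a trace class depends only on j.
-/
theorem card_filter_trace_le {W : Finset SL(2, F)} {j : ℕ}
    (hW : ∀ M ∈ W, #(traceRoots (M 0 0 + M 1 1)) = j) :
    #W ≤ (Fintype.card F * (Fintype.card F - 1) + Fintype.card F * j) *
      #(W.image fun M => M 0 0 + M 1 1) := by
  refine card_le_mul_card_image _ _ ?_
  intro t ht
  obtain ⟨N, hN, rfl⟩ := mem_image.1 ht
  rw [← hW N hN, ← card_trace_eq]
  exact card_le_card (filter_subset_filter _ (subset_univ _))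

/-- The eigenvalues lie in Fˣ, so they are killed by both n and q - 1. The hypothesis `h1` puts the
square roots of 1 among the gcd-th roots of unity, so they can be discounted. -/
theorem two_mul_card_split_add_le {n : ℕ} (hn : 0 < n) (h1 : ∀ x : F, x * x = 1 → x ^ n = 1)
    {W : Finset SL(2, F)} (hWn : ∀ M ∈ W, M ^ n = 1)
    (hW : ∀ M ∈ W, #(traceRoots (M 0 0 + M 1 1)) = 2) :
    2 * #(W.image fun M => M 0 0 + M 1 1) + signCard F ≤ n.gcd (Fintype.card F - 1) := by
  refine two_mul_card_add_le (Ω := F) (Nat.gcd_pos_of_pos_left _ hn)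
    (fun x hx => pow_gcd_eq_one.2 ⟨h1 x hx, (pow_eq_one_of_mul_self hx).1⟩) ?_
  intro t ht
  obtain ⟨M, hM, rfl⟩ := mem_image.1 ht
  obtain ⟨x, hx, hxx⟩ := exists_of_card_traceRoots_eq_two (hW M hM)
  have hx0 : x ≠ 0 := by
    rintro rfl
    simp at hx
  exact ⟨x, hx, hxx, pow_gcd_eq_one.2
    ⟨eigenvalue_pow_eq_one (K := F) M.det_coe (coe_pow_eq_one (hWn M hM)) hx,
    FiniteField.pow_card_sub_one_eq_one x hx0⟩⟩

theorem two_mul_card_nonsplit_add_le {n : ℕ} (hn : 0 < n) (h1 : ∀ x : F, x * x = 1 → x ^ n = 1)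
    {W : Finset SL(2, F)} (hWn : ∀ M ∈ W, M ^ n = 1)
    (hW : ∀ M ∈ W, #(traceRoots (M 0 0 + M 1 1)) = 0) :
    2 * #(W.image fun M => M 0 0 + M 1 1) + signCard F ≤ n.gcd (Fintype.card F + 1) := by
  refine two_mul_card_add_le (Ω := AlgebraicClosure F) (Nat.gcd_pos_of_pos_left _ hn)
    (fun x hx => pow_gcd_eq_one.2 ⟨h1 x hx, (pow_eq_one_of_mul_self hx).2⟩) ?_
  intro t ht
  obtain ⟨M, hM, rfl⟩ := mem_image.1 ht
  obtain ⟨x, hx, hxx, hxq⟩ := exists_of_card_traceRoots_eq_zero (hW M hM)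
  exact ⟨x, hx, hxx, pow_gcd_eq_one.2
    ⟨eigenvalue_pow_eq_one M.det_coe (coe_pow_eq_one (hWn M hM)) hx, hxq⟩⟩

/-- The trace is 2x with x² = 1, which leaves at most `signCard F` classes of q² matrices. If n is
nonzero in F, only scalar matrices survive. -/
theorem card_unipotent_le {n : ℕ} {W : Finset SL(2, F)} (hWn : ∀ M ∈ W, M ^ n = 1)
    (hW : ∀ M ∈ W, #(traceRoots (M 0 0 + M 1 1)) = 1) :
    #W ≤ signCard F * if (n : F) = 0 then Fintype.card F ^ 2 else 1 := by
  split_ifs with hn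
  · have hT : #(W.image fun M => M 0 0 + M 1 1) ≤ signCard F := by
      have : (W.image fun M => M 0 0 + M 1 1) ⊆ ({x : F | x * x = 1} : Finset F).image (2 * ·) := by
        intro t ht
        obtain ⟨M, hM, rfl⟩ := mem_image.1 ht
        obtain ⟨x, hx, hxt⟩ := exists_of_card_traceRoots_eq_one (hW M hM)
        exact mem_image.2 ⟨x, by simpa using hx, hxt.symm⟩
      exact (card_le_card this).trans card_image_le
    have hq : Fintype.card F * (Fintype.card F - 1) + Fintype.card F * 1 = Fintype.card F ^ 2 := by
      rw [← mul_add, Nat.sub_add_cancel Fintype.card_pos, sq]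
    calc #W ≤ _ := card_filter_trace_le hW
      _ ≤ _ := by rw [hq, mul_comm]; exact Nat.mul_le_mul_right _ hT
  · have hs : ∀ M ∈ W, ∃ x : F, x * x = 1 ∧ (M : Matrix (Fin 2) (Fin 2) F) = x • 1 := by
      intro M hM
      obtain ⟨x, hx, hxt⟩ := exists_of_card_traceRoots_eq_one (hW M hM)
      exact ⟨x, hx, eq_scalar_of_pow_eq_one M.det_coe hn (coe_pow_eq_one (hWn M hM)) hx hxt⟩
    rw [mul_one]
    refine card_le_card_of_injOn (fun M => M 0 0) ?_ ?_
    · intro M hM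
      obtain ⟨x, hx, hMx⟩ := hs M hM
      simp [hMx, hx]
    · intro M hM N hN hMN
      obtain ⟨x, hx, hMx⟩ := hs M hM
      obtain ⟨y, hy, hNy⟩ := hs N hN
      apply Subtype.ext
      simp [hMx, hNy] at hMN
      change (M : Matrix (Fin 2) (Fin 2) F) = N
      rw [hMx, hNy, hMN]

/-- An upper bound for the number of solutions of `M ^ n = 1` in `SL(2, F)`. -/
theorem two_mul_card_pow_eq_one_le {n : ℕ} (hn : 0 < n) (h1 : ∀ x : F, x * x = 1 → x ^ n = 1) :
    (2 * #{M : SL(2, F) | M ^ n = 1} : ℚ) ≤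
      2 * signCard F * (if (n : F) = 0 then (Fintype.card F : ℚ) ^ 2 else 1) +
      Fintype.card F * (Fintype.card F + 1) *
        ((n.gcd (Fintype.card F - 1) : ℚ) - signCard F) +
      Fintype.card F * (Fintype.card F - 1) *
        ((n.gcd (Fintype.card F + 1) : ℚ) - signCard F) := by
  set W : Finset SL(2, F) := {M : SL(2, F) | M ^ n = 1} with hW
  set q := Fintype.card F with hq
  have hq1 : 1 ≤ q := Fintype.card_pos
  have hWn : ∀ j, ∀ M ∈ {M ∈ W | #(traceRoots (M 0 0 + M 1 1)) = j}, M ^ n = 1 :=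
    fun j M hM => (mem_filter.1 (mem_filter.1 hM).1).2
  have hWj : ∀ j, ∀ M ∈ {M ∈ W | #(traceRoots (M 0 0 + M 1 1)) = j},
      #(traceRoots (M 0 0 + M 1 1)) = j := fun j M hM => (mem_filter.1 hM).2
  have hsum : #W = ∑ j ∈ range 3, #{M ∈ W | #(traceRoots (M 0 0 + M 1 1)) = j} :=
    card_eq_sum_card_fiberwise fun M _ => by
      have := card_traceRoots_le_two (M 0 0 + M 1 1)
      simp only [coe_range, Set.mem_Iio]
      omega
  simp only [sum_range_succ, range_zero, sum_empty, zero_add] at hsum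
  have b0 := card_filter_trace_le (hWj 0)
  have b2 := card_filter_trace_le (hWj 2)
  have b1 := card_unipotent_le (hWn 1) (hWj 1)
  have t0 := two_mul_card_nonsplit_add_le hn h1 (hWn 0) (hWj 0)
  have t2 := two_mul_card_split_add_le hn h1 (hWn 2) (hWj 2)
  rw [← hq] at b0 b1 b2 t0 t2
  rw [hsum]
  generalize #{M ∈ W | #(traceRoots (M 0 0 + M 1 1)) = 0} = w0 at *
  generalize #{M ∈ W | #(traceRoots (M 0 0 + M 1 1)) = 1} = w1 at *
  generalize #{M ∈ W | #(traceRoots (M 0 0 + M 1 1)) = 2} = w2 at *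
  set T0 := #(image (fun M : SL(2, F) => M 0 0 + M 1 1)
    {M ∈ W | #(traceRoots (M 0 0 + M 1 1)) = 0})
  set T2 := #(image (fun M : SL(2, F) => M 0 0 + M 1 1)
    {M ∈ W | #(traceRoots (M 0 0 + M 1 1)) = 2})
  generalize n.gcd (q - 1) = g1 at *
  generalize n.gcd (q + 1) = g2 at *
  qify [hq1] at b0 b1 b2 t0 t2 ⊢
  have hq2 : (1 : ℚ) ≤ q := by exact_mod_cast hq1
  have c0 := mul_le_mul_of_nonneg_left t0 (by nlinarith : (0 : ℚ) ≤ q * (q - 1))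
  have c2 := mul_le_mul_of_nonneg_left t2 (by nlinarith : (0 : ℚ) ≤ q * (q + 1))
  linarith

end UpperBound

/-! ### Passage from SL(2,q) to PSL(2,q) -/

section Quotient

theorem mem_center_sl2_iff {F : Type*} [Field F] {M : SL(2, F)} :
    M ∈ Subgroup.center SL(2, F) ↔
      ∃ x : F, x * x = 1 ∧ (M : Matrix (Fin 2) (Fin 2) F) = x • 1 := by
  rw [Matrix.SpecialLinearGroup.mem_center_iff]
  refine exists_congr fun x => ?_
  rw [Fintype.card_fin, sq, scalar_apply, ← smul_one_eq_diagonal]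
  exact and_congr_right fun _ => eq_comm

variable {F : Type*} [Field F] [Fintype F] [DecidableEq F]

theorem signCard_of_two_eq_zero (h : (2 : F) = 0) : signCard F = 1 := by
  rw [signCard, card_eq_one]
  refine ⟨1, ?_⟩
  ext x
  have h1 : (1 : F) = -1 := by linear_combination h
  simp only [mem_filter, mem_univ, true_and, mem_singleton, mul_self_eq_one_iff, ← h1, or_self]

theorem signCard_of_two_ne_zero (h : (2 : F) ≠ 0) : signCard F = 2 := by
  have h1 : (1 : F) ≠ -1 := fun h1 => h (by linear_combination h1)
  rw [signCard, ← card_pair h1]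
  congr 1
  ext x
  simp [mul_self_eq_one_iff]

theorem card_center_sl2 : Nat.card (Subgroup.center SL(2, F)) = signCard F := by
  rw [signCard, ← Fintype.card_coe, ← Nat.card_eq_fintype_card]
  refine Nat.card_congr (Equiv.ofBijective
    (fun M => ⟨(M : SL(2, F)) 0 0, ?_⟩) ⟨?_, ?_⟩)
  · obtain ⟨x, hx, hM⟩ := mem_center_sl2_iff.1 M.2
    simp [hM, hx]
  · rintro ⟨M, hM⟩ ⟨N, hN⟩ h
    obtain ⟨x, hx, hMx⟩ := mem_center_sl2_iff.1 hM
    obtain ⟨y, hy, hNy⟩ := mem_center_sl2_iff.1 hN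
    have hxy : x = y := by simpa [hMx, hNy] using h
    apply Subtype.ext
    apply Subtype.ext
    change (M : Matrix (Fin 2) (Fin 2) F) = N
    rw [hMx, hNy, hxy]
  · rintro ⟨x, hx⟩
    have hx : x * x = 1 := by simpa using hx
    refine ⟨⟨⟨x • 1, by
      rw [det_fin_two]
      simpa using hx⟩, mem_center_sl2_iff.2 ⟨x, hx, rfl⟩⟩, ?_⟩
    simp

/-- In odd characteristic N² = 1 and Cayley–Hamilton give tr(N)·N = 2, so N is scalar. In
characteristic 2 the exponent is 1. -/
theorem mem_center_of_pow_signCard {N : SL(2, F)} (h : N ^ signCard F = 1) :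
    N ∈ Subgroup.center SL(2, F) := by
  by_cases h2 : (2 : F) = 0
  · rw [signCard_of_two_eq_zero h2, pow_one] at h
    rw [h]
    exact one_mem _
  · rw [signCard_of_two_ne_zero h2] at h
    have hsq := sq_eq_of_det_eq_one N.det_coe
    rw [coe_pow_eq_one h] at hsq
    have hN : (N 0 0 + N 1 1) • (N : Matrix (Fin 2) (Fin 2) F) = (2 : F) • 1 := by
      rw [two_smul]
      exact (eq_add_of_sub_eq hsq.symm)
    have ht : N 0 0 + N 1 1 ≠ 0 := by
      intro ht
      rw [ht, zero_smul] at hN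
      exact h2 (by simpa using (congrFun (congrFun hN 0) 0).symm)
    have hN2 : (N : Matrix (Fin 2) (Fin 2) F) = ((N 0 0 + N 1 1)⁻¹ * 2) • 1 := by
      rw [mul_smul, ← hN, smul_smul, inv_mul_cancel₀ ht, one_smul]
    refine mem_center_sl2_iff.2 ⟨(N 0 0 + N 1 1)⁻¹ * 2, ?_, hN2⟩
    have hdet := N.det_coe
    rw [hN2, det_fin_two] at hdet
    simpa using hdet

theorem psl2_mk_pow_eq_one_iff {M : SL(2, F)} {k : ℕ} :
    (M : PSL2 F) ^ k = 1 ↔ M ^ (signCard F * k) = 1 := by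
  rw [← QuotientGroup.mk_pow, QuotientGroup.eq_one_iff, mul_comm, pow_mul]
  refine ⟨fun h => ?_, mem_center_of_pow_signCard⟩
  have := pow_card_eq_one' (x := (⟨M ^ k, h⟩ : Subgroup.center SL(2, F)))
  rw [card_center_sl2] at this
  exact congrArg Subtype.val this

theorem signCard_mul_ncard_solutionSet (k : ℕ) :
    signCard F * (solutionSet (PSL2 F) k).ncard =
      #{M : SL(2, F) | M ^ (signCard F * k) = 1} := by
  have h := QuotientGroup.card_preimage_mk (Subgroup.center SL(2, F)) (solutionSet (PSL2 F) k)
  rw [card_center_sl2, Nat.card_coe_set_eq, Nat.card_coe_set_eq] at h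
  rw [← h, ← Set.ncard_coe_finset]
  congr 1
  ext M
  simp only [coe_filter, mem_univ, true_and, Set.mem_ofPred_eq]
  exact psl2_mk_pow_eq_one_iff (M := M)

variable (F) in
theorem card_sl2_eq : Nat.card SL(2, F) = signCard F * Nat.card (PSL2 F) := by
  rw [← card_center_sl2 (F := F), mul_comm]
  exact Subgroup.card_eq_card_quotient_mul_card_subgroup _

variable (F) in
-- The diagonal torus is a subgroup isomorphic to Fˣ.
theorem card_sub_one_dvd_card_sl2 : Fintype.card F - 1 ∣ Nat.card SL(2, F) := by
  let f : Fˣ →* SL(2, F) :=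
    { toFun := fun u => ⟨!![(u : F), 0; 0, ((u⁻¹ : Fˣ) : F)], by simp [det_fin_two]⟩
      map_one' := by
        ext i j
        fin_cases i <;> fin_cases j <;> simp
      map_mul' := fun u v => Subtype.ext <| by
        change (_ : Matrix (Fin 2) (Fin 2) F) = !![_, _; _, _] * !![_, _; _, _]
        rw [mul_fin_two]
        simp [mul_comm] }
  have hf : Function.Injective f := fun u v h => by
    exact Units.ext (congrArg (fun M : SL(2, F) => M 0 0) h)
  have := Subgroup.card_dvd_of_injective f hf
  rwa [Nat.card_eq_fintype_card, Fintype.card_units] at this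

end Quotient

/-! ### Lower bounds at the extremal exponents -/

section LowerBound

variable {F : Type*} [Field F] [Fintype F] [DecidableEq F]

/-- In characteristic 2, trace 0 means A² = -1 = 1. As x² + 1 has the single root 1, there are q²
such matrices. -/
theorem card_sq_le_of_two_eq_zero (h : (2 : F) = 0) :
    Fintype.card F ^ 2 ≤ #{M : SL(2, F) | M ^ 2 = 1} := by
  have h1 : (1 : F) = -1 := by linear_combination h
  have hr : (1 : F) ∈ traceRoots 0 := by
    rw [mem_traceRoots]
    linear_combination h
  have hc := card_trace_eq (0 : F)
  rw [traceRoots_eq_pair hr, inv_one, pair_eq_singleton, card_singleton, ← mul_add,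
    Nat.sub_add_cancel Fintype.card_pos, ← sq] at hc
  rw [← hc]
  apply card_le_card
  intro M hM
  rw [mem_filter] at hM ⊢
  refine ⟨mem_univ _, Subtype.ext ?_⟩
  change ((M ^ 2 : SL(2, F)) : Matrix (Fin 2) (Fin 2) F) = 1
  rw [Matrix.SpecialLinearGroup.coe_pow, sq_eq_of_det_eq_one M.det_coe, hM.2, zero_smul, zero_sub,
    ← neg_one_smul F, ← h1, one_smul]

/-- The matrices with two eigenvalues in `F`, together with the central ones, are killed by
`q - 1`. -/
theorem card_split_le :
    Fintype.card F * (Fintype.card F + 1) * (Fintype.card F - 1) + 2 * signCard F ≤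
      2 * #{M : SL(2, F) | M ^ (Fintype.card F - 1) = 1} +
        Fintype.card F * (Fintype.card F + 1) * signCard F := by
  set q := Fintype.card F with hq
  set U : Finset F := {x : F | x ≠ 0 ∧ x * x ≠ 1} with hU
  set T : Finset F := U.image fun x => x + x⁻¹ with hT
  have hroot : ∀ {x t : F}, x ≠ 0 → (x + x⁻¹ = t ↔ x * x + 1 = t * x) := by
    intro x t hx
    rw [← mul_left_inj' hx, add_mul, inv_mul_cancel₀ hx]
  -- The map x ↦ x + x⁻¹ is at most two-to-one, its fibres being sets of roots of x² - tx + 1.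
  have hUT : #U ≤ 2 * #T := by
    refine card_le_mul_card_image _ _ fun t _ => (card_le_card ?_).trans (card_traceRoots_le_two t)
    intro x hx
    simp only [hU, mem_filter, mem_univ, true_and] at hx
    exact mem_traceRoots.2 ((hroot hx.1.1).1 hx.2)
  have hUc : q = #U + signCard F + 1 := by
    have h1 := card_filter_add_card_filter_not (s := (univ : Finset F)) (fun x => x = 0)
    have h2 := card_filter_add_card_filter_not (s := ({x : F | ¬ x = 0} : Finset F))
      (fun x => x * x = 1)
    rw [filter_filter, filter_filter] at h2
    have h3 : ({x : F | ¬ x = 0 ∧ x * x = 1} : Finset F) = ({x : F | x * x = 1} : Finset F) := by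
      ext x
      simp only [mem_filter, mem_univ, true_and, and_iff_right_iff_imp]
      rintro h rfl
      simp at h
    rw [h3] at h2
    simp only [filter_eq', mem_univ, if_true, card_singleton, card_univ] at h1
    rw [hq, ← h1, ← h2]
    simp only [signCard, hU, ne_eq]
    omega
  have hTr : ∀ t ∈ T, #(traceRoots t) = 2 ∧ ∃ x : F, x * x ≠ 1 ∧ x * x + 1 = t * x := by
    intro t ht
    obtain ⟨x, hx, hxt⟩ := mem_image.1 ht
    simp only [hU, mem_filter, mem_univ, true_and] at hx
    have hxr := (hroot hx.1).1 hxt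
    refine ⟨?_, x, hx.2, hxr⟩
    rw [traceRoots_eq_pair (mem_traceRoots.2 hxr), card_pair]
    exact fun h => hx.2 ((mul_eq_one_iff_eq_inv₀ hx.1).2 h)
  set A : Finset SL(2, F) := {M : SL(2, F) | M 0 0 + M 1 1 ∈ T} with hA
  set C : Finset SL(2, F) := {M : SL(2, F) | M ∈ Subgroup.center SL(2, F)} with hC
  have hAc : #A = #T * (q * (q - 1) + q * 2) := by
    rw [card_eq_sum_card_fiberwise (f := fun M : SL(2, F) => M 0 0 + M 1 1) (t := T)
      (fun M hM => by simpa [hA] using hM), ← smul_eq_mul, ← sum_const]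
    refine sum_congr rfl fun t ht => ?_
    have hc := card_trace_eq t
    rw [(hTr t ht).1] at hc
    rw [← hc]
    congr 1
    ext M
    simp only [hA, mem_filter, mem_univ, true_and, and_iff_right_iff_imp]
    rintro rfl
    exact ht
  have hCc : #C = signCard F := by
    rw [← card_center_sl2, Nat.card_eq_fintype_card, Fintype.card_subtype]
  have hdisj : Disjoint A C := by
    rw [disjoint_left]
    intro M hMA hMC
    simp only [hA, hC, mem_filter, mem_univ, true_and] at hMA hMC
    obtain ⟨x, hx, hM⟩ := mem_center_sl2_iff.1 hMC
    obtain ⟨y, hy, hyr⟩ := (hTr _ hMA).2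
    have ht : M 0 0 + M 1 1 = x + x := by simp [hM]
    rw [ht] at hyr
    have : (y - x) ^ 2 = 0 := by linear_combination hyr + hx
    rw [sub_eq_zero.1 (pow_eq_zero_iff two_ne_zero |>.1 this)] at hy
    exact hy hx
  have hsub : A ∪ C ⊆ ({M : SL(2, F) | M ^ (q - 1) = 1} : Finset _) := by
    intro M hM
    rw [mem_filter]
    refine ⟨mem_univ _, Subtype.ext ?_⟩
    change ((M ^ (q - 1) : SL(2, F)) : Matrix (Fin 2) (Fin 2) F) = 1
    rw [Matrix.SpecialLinearGroup.coe_pow]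
    rcases mem_union.1 hM with hM | hM
    · simp only [hA, mem_filter, mem_univ, true_and] at hM
      obtain ⟨x, hx, hxr⟩ := (hTr _ hM).2
      exact pow_card_sub_one_eq_one M.det_coe hx hxr
    · simp only [hC, mem_filter, mem_univ, true_and] at hM
      obtain ⟨x, hx, hM⟩ := mem_center_sl2_iff.1 hM
      rw [hM, smul_pow, (pow_eq_one_of_mul_self hx).1, one_pow, one_smul]
  have hle := card_le_card hsub
  rw [card_union_of_disjoint hdisj, hAc, hCc] at hle
  have hq1 : 1 ≤ q := Fintype.card_pos
  generalize #{M : SL(2, F) | M ^ (q - 1) = 1} = w at *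
  generalize #T = τ at *
  have hs := Nat.mul_le_mul_left (q * (q + 1)) hUT
  generalize #U = u at *
  have hu : q - 1 = u + signCard F := by omega
  rw [hu] at hle ⊢
  clear_value q
  subst hUc
  nlinarith

end LowerBound

/-! ### Polynomial inequalities -/

section Arithmetic

/-- The three factors are pairwise coprime divisors of k. Taking p = 1 covers exponents prime to the
characteristic. -/
theorem mul_gcd_mul_gcd_le {p k m₁ m₂ : ℕ} (hk : 0 < k) (hp : p ∣ k) (h₁ : p.Coprime m₁)
    (h₂ : p.Coprime m₂) (h₁₂ : m₁.Coprime m₂) : p * (k.gcd m₁ * k.gcd m₂) ≤ k := by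
  have hc : (k.gcd m₁).Coprime (k.gcd m₂) :=
    (h₁₂.coprime_dvd_left (Nat.gcd_dvd_right _ _)).coprime_dvd_right (Nat.gcd_dvd_right _ _)
  have hpc : p.Coprime (k.gcd m₁ * k.gcd m₂) :=
    (h₁.coprime_dvd_right (Nat.gcd_dvd_right _ _)).mul_right
      (h₂.coprime_dvd_right (Nat.gcd_dvd_right _ _))
  exact Nat.le_of_dvd hk (hpc.mul_dvd_of_dvd_of_dvd hp
    (hc.mul_dvd_of_dvd_of_dvd (Nat.gcd_dvd_left _ _) (Nat.gcd_dvd_left _ _)))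

/-- Here q = 2a + 1. For y = 1 the right side minus the left is (2a + 3)(a - x), so equality holds
at x = a, the extremal exponent. -/
theorem odd_semisimple_bound {a x y : ℕ} (ha : 2 ≤ a) (hx : 1 ≤ x) (hxa : x ≤ a) (hy : 1 ≤ y)
    (hya : y ≤ a + 1) :
    (1 + (x - 1) * ((2 * a + 1) * (a + 1)) + (y - 1) * ((2 * a + 1) * a) : ℚ) ≤
      x * y * ((2 * a + 1) * a - 2) := by
  have ha' : (2 : ℚ) ≤ a := by exact_mod_cast ha
  have hxa' : (x : ℚ) ≤ a := by exact_mod_cast hxa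
  have hya' : (y : ℚ) ≤ a + 1 := by exact_mod_cast hya
  rcases hx.eq_or_lt with rfl | hx
  · push_cast
    nlinarith
  rcases hy.eq_or_lt with rfl | hy
  · push_cast
    nlinarith
  -- Now a, x, y ≥ 2; in the shifted variables the difference has only nonnegative coefficients.
  obtain ⟨b, rfl⟩ := Nat.exists_eq_add_of_le ha
  obtain ⟨u, rfl⟩ := Nat.exists_eq_add_of_le hx
  obtain ⟨v, rfl⟩ := Nat.exists_eq_add_of_le hy
  rw [← sub_nonneg]
  push_cast
  ring_nf
  positivity

/-- The left side is at most xyq², so q² ≤ p(qa - 2) suffices. This fails for p = 3, a = 2, where it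
reads 25 ≤ 24. -/
theorem odd_unipotent_bound {a p x y k : ℕ} (ha : 2 ≤ a) (hp : 3 ≤ p) (hpa : p = 3 → a ≠ 2)
    (hx : 1 ≤ x) (hy : 1 ≤ y) (hk : p * (x * y) ≤ k) :
    ((2 * a + 1) ^ 2 + (x - 1) * ((2 * a + 1) * (a + 1)) + (y - 1) * ((2 * a + 1) * a) : ℚ) ≤
      k * ((2 * a + 1) * a - 2) := by
  have ha' : (2 : ℚ) ≤ a := by exact_mod_cast ha
  have hx' : (1 : ℚ) ≤ x := by exact_mod_cast hx
  have hy' : (1 : ℚ) ≤ y := by exact_mod_cast hy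
  have hk' : (p * (x * y) : ℚ) ≤ k := by exact_mod_cast hk
  have h1 : (0 : ℚ) ≤ (2 * a + 1) * a - 2 := by nlinarith
  have h2 : ((2 * a + 1) ^ 2 : ℚ) ≤ p * ((2 * a + 1) * a - 2) := by
    rcases hp.eq_or_lt with rfl | hp
    · have : 3 ≤ a := by have := hpa rfl; omega
      have : (3 : ℚ) ≤ a := by exact_mod_cast this
      push_cast
      nlinarith
    · have : (4 : ℚ) ≤ p := by exact_mod_cast hp
      nlinarith [mul_le_mul_of_nonneg_right this h1]
  have h3 : ((2 * a + 1) ^ 2 + (x - 1) * ((2 * a + 1) * (a + 1)) + (y - 1) * ((2 * a + 1) * a) : ℚ)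
      ≤ x * y * (2 * a + 1) ^ 2 := by
    have hA : (x * ((2 * a + 1) * (a + 1)) : ℚ) ≤ x * y * ((2 * a + 1) * (a + 1)) :=
      mul_le_mul_of_nonneg_right (by nlinarith) (by positivity)
    have hB : (y * ((2 * a + 1) * a) : ℚ) ≤ x * y * ((2 * a + 1) * a) :=
      mul_le_mul_of_nonneg_right (by nlinarith) (by positivity)
    linarith
  calc _ ≤ (x * y * (2 * a + 1) ^ 2 : ℚ) := h3
    _ ≤ x * y * (p * ((2 * a + 1) * a - 2)) := mul_le_mul_of_nonneg_left h2 (by positivity)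
    _ = p * (x * y) * ((2 * a + 1) * a - 2) := by ring
    _ ≤ _ := mul_le_mul_of_nonneg_right hk' h1

theorem even_semisimple_bound {q x y : ℕ} (hx : 1 ≤ x) (hxq : x + 1 ≤ q) (hy : 1 ≤ y) :
    (2 + q * (q + 1) * (x - 1) + q * (q - 1) * (y - 1) : ℚ) ≤ x * y * q ^ 2 := by
  obtain ⟨u, rfl⟩ := Nat.exists_eq_add_of_le hx
  obtain ⟨v, rfl⟩ := Nat.exists_eq_add_of_le hy
  obtain ⟨w, rfl⟩ := Nat.exists_eq_add_of_le hxq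
  rw [← sub_nonneg]
  push_cast
  ring_nf
  positivity

theorem even_unipotent_bound {q x y k : ℕ} (hq : 1 ≤ q) (hx : 1 ≤ x) (hy : 1 ≤ y)
    (hk : 2 * (x * y) ≤ k) :
    (2 * q ^ 2 + q * (q + 1) * (x - 1) + q * (q - 1) * (y - 1) : ℚ) ≤ k * q ^ 2 := by
  have hk' : (2 * (x * y) * q ^ 2 : ℚ) ≤ k * q ^ 2 :=
    mul_le_mul_of_nonneg_right (by exact_mod_cast hk) (by positivity)
  refine le_trans ?_ hk'
  obtain ⟨u, rfl⟩ := Nat.exists_eq_add_of_le hx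
  obtain ⟨v, rfl⟩ := Nat.exists_eq_add_of_le hy
  obtain ⟨w, rfl⟩ := Nat.exists_eq_add_of_le hq
  rw [← sub_nonneg]
  push_cast
  ring_nf
  positivity

end Arithmetic

/-- The upper bound is available for every positive exponent, so divisibility matters only at the
extremal k. -/
theorem globalBreadth_eq {G : Type*} [Group G] [Finite G] {k : ℕ} {b : ℚ} (hk : k ∣ Nat.card G)
    (hle : ∀ l, 0 < l → localBreadth G l ≤ b) (hge : b ≤ localBreadth G k) :
    globalBreadth G = b ∧ k ∣ Nat.card G ∧ localBreadth G k = globalBreadth G := by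
  have h1 : globalBreadth G ≤ b :=
    Finset.sup'_le _ _ fun l hl => hle l (Nat.pos_of_mem_divisors hl)
  have h2 : localBreadth G k ≤ globalBreadth G :=
    Finset.le_sup' (localBreadth G) (Nat.mem_divisors.2 ⟨hk, Nat.card_pos.ne'⟩)
  exact ⟨le_antisymm h1 (hge.trans h2), hk, le_antisymm h2 (h1.trans hge)⟩

/-! ### Local breadths of PSL(2,q) -/

section PSL2

theorem exists_char_prime {F : Type*} [Field F] [Fintype F] {k : ℕ} (hk : (k : F) = 0) :
    ∃ p : ℕ, p.Prime ∧ p ∣ k ∧ p ∣ Fintype.card F := by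
  obtain ⟨p, hp⟩ := CharP.exists F
  obtain ⟨n, hpp, -⟩ := FiniteField.card F p
  exact ⟨p, hpp, (CharP.cast_eq_zero_iff F p k).1 hk,
    (CharP.cast_eq_zero_iff F p _).1 (Nat.cast_card_eq_zero F)⟩

variable {F : Type*} [Field F] [Fintype F] [DecidableEq F]

theorem pow_signCard_mul {x : F} (hx : x * x = 1) (k : ℕ) : x ^ (signCard F * k) = 1 := by
  rw [pow_mul]
  by_cases h2 : (2 : F) = 0
  · have h1 : (1 : F) = -1 := by linear_combination h2
    have : x = 1 := by simpa [mul_self_eq_one_iff, ← h1] using hx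
    rw [this, one_pow, one_pow]
  · rw [signCard_of_two_ne_zero h2, sq, hx, one_pow]

theorem localBreadth_psl2_le_of_odd {a : ℕ} (hq : Fintype.card F = 2 * a + 1) (ha : 2 ≤ a)
    (h2 : (2 : F) ≠ 0) {k : ℕ} (hk : 0 < k) :
    localBreadth (PSL2 F) k ≤ (2 * a + 1) * a - 2 := by
  have hk' : (0 : ℚ) < k := by exact_mod_cast hk
  rw [localBreadth, div_le_iff₀ hk', mul_comm]
  have hs := signCard_of_two_ne_zero h2
  have hS := signCard_mul_ncard_solutionSet (F := F) k
  have hU := two_mul_card_pow_eq_one_le (F := F) (n := signCard F * k) (by rw [hs]; omega)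
    fun x hx => pow_signCard_mul hx k
  -- gcd(2k, 2a) = 2 gcd(k, a), and likewise for a + 1: the factor 2 matches the order of the
  -- center.
  rw [← hS, hs, hq, show 2 * a + 1 - 1 = 2 * a by omega, show 2 * a + 1 + 1 = 2 * (a + 1) by ring,
    Nat.gcd_mul_left, Nat.gcd_mul_left] at hU
  simp only [Nat.cast_mul, Nat.cast_ofNat, mul_eq_zero, h2, false_or, Nat.cast_add,
    Nat.cast_one] at hU
  have hx : 1 ≤ k.gcd a := Nat.gcd_pos_of_pos_left _ hk
  have hy : 1 ≤ k.gcd (a + 1) := Nat.gcd_pos_of_pos_left _ hk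
  have hcop : a.Coprime (a + 1) := Nat.isCoprime_iff_coprime.1 ⟨-1, 1, by push_cast; ring⟩
  split_ifs at hU with hkF
  · obtain ⟨p, hp, hpk, hpq⟩ := exists_char_prime hkF
    rw [hq] at hpq
    have hp3 : 3 ≤ p := by
      rcases hp.two_le.eq_or_lt with rfl | h
      · omega
      · exact h
    -- The excluded pair p = 3, a = 2 would require 3 ∣ 5.
    have hb := odd_unipotent_bound ha hp3 (by rintro rfl rfl; omega) hx hy
      (mul_gcd_mul_gcd_le hk hpk
        ((Nat.isCoprime_iff_coprime.1 ⟨1, -2, by push_cast; ring⟩ :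
          (2 * a + 1).Coprime a).coprime_dvd_left hpq)
        ((Nat.isCoprime_iff_coprime.1 ⟨-1, 2, by push_cast; ring⟩ :
          (2 * a + 1).Coprime (a + 1)).coprime_dvd_left hpq) hcop)
    linarith
  · have hb := odd_semisimple_bound ha hx (Nat.gcd_le_right _ (by omega)) hy
      (Nat.gcd_le_right _ (by omega))
    have hxy := mul_gcd_mul_gcd_le hk (one_dvd k) (Nat.coprime_one_left a)
      (Nat.coprime_one_left (a + 1)) hcop
    rw [one_mul] at hxy
    have hxy' : ((k.gcd a : ℚ) * k.gcd (a + 1)) ≤ k := by exact_mod_cast hxy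
    have ha' : (2 : ℚ) ≤ a := by exact_mod_cast ha
    have := mul_le_mul_of_nonneg_right hxy' (by nlinarith : (0 : ℚ) ≤ (2 * a + 1) * a - 2)
    linarith

theorem le_localBreadth_psl2_of_odd {a : ℕ} (hq : Fintype.card F = 2 * a + 1) (ha : 2 ≤ a)
    (h2 : (2 : F) ≠ 0) : ((2 * a + 1) * a - 2 : ℚ) ≤ localBreadth (PSL2 F) a := by
  have ha' : (0 : ℚ) < a := by
    have : 0 < a := by omega
    exact_mod_cast this
  rw [localBreadth, le_div_iff₀ ha']
  have hs := signCard_of_two_ne_zero h2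
  have hS := signCard_mul_ncard_solutionSet (F := F) a
  have hL := card_split_le (F := F)
  rw [hq, hs, Nat.add_sub_cancel] at hL
  rw [hs] at hS
  rw [← hS] at hL
  have hL' : (((2 * a + 1) * (2 * a + 1 + 1) * (2 * a) + 2 * 2 : ℕ) : ℚ) ≤
    ((2 * (2 * (solutionSet (PSL2 F) a).ncard) + (2 * a + 1) * (2 * a + 1 + 1) * 2 : ℕ) : ℚ) := by
    exact_mod_cast hL
  push_cast at hL'
  linarith

theorem localBreadth_psl2_le_of_even (h2 : (2 : F) = 0) {k : ℕ} (hk : 0 < k) :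
    localBreadth (PSL2 F) k ≤ (Fintype.card F : ℚ) ^ 2 / 2 := by
  have hk' : (0 : ℚ) < k := by exact_mod_cast hk
  rw [localBreadth, div_le_iff₀ hk']
  have hs := signCard_of_two_eq_zero h2
  have hS := signCard_mul_ncard_solutionSet (F := F) k
  have hU := two_mul_card_pow_eq_one_le (F := F) (n := signCard F * k) (by rw [hs]; omega)
    fun x hx => pow_signCard_mul hx k
  rw [← hS, hs, one_mul, one_mul] at hU
  simp only [Nat.cast_one, mul_one] at hU
  have hq1 : 1 < Fintype.card F := Fintype.one_lt_card
  obtain ⟨c, hc⟩ : 2 ∣ Fintype.card F := by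
    obtain ⟨p, hp, hp2, hpq⟩ := exists_char_prime (F := F) (k := 2) (by exact_mod_cast h2)
    rwa [(Nat.prime_dvd_prime_iff_eq hp Nat.prime_two).1 hp2] at hpq
  have hx : 1 ≤ k.gcd (Fintype.card F - 1) := Nat.gcd_pos_of_pos_left _ hk
  have hy : 1 ≤ k.gcd (Fintype.card F + 1) := Nat.gcd_pos_of_pos_left _ hk
  have hcop : (Fintype.card F - 1).Coprime (Fintype.card F + 1) := by
    -- With q = 2c, c(q - 1) - (c - 1)(q + 1) = 1.
    refine Nat.isCoprime_iff_coprime.1 ⟨c, -(c - 1), ?_⟩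
    rw [hc] at hq1 ⊢
    rw [Nat.cast_sub hq1.le]
    push_cast
    ring
  split_ifs at hU with hkF
  · obtain ⟨p, hp, hpk, hpq⟩ := exists_char_prime hkF
    have hp2 := hp.two_le
    have h := mul_gcd_mul_gcd_le hk hpk
      ((Nat.isCoprime_iff_coprime.1 ⟨1, -1, by rw [Nat.cast_sub hq1.le]; push_cast; ring⟩ :
        (Fintype.card F).Coprime (Fintype.card F - 1)).coprime_dvd_left hpq)
      ((Nat.isCoprime_iff_coprime.1 ⟨-1, 1, by push_cast; ring⟩ :
        (Fintype.card F).Coprime (Fintype.card F + 1)).coprime_dvd_left hpq) hcop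
    have hb := even_unipotent_bound hq1.le hx hy ((Nat.mul_le_mul_right _ hp2).trans h)
    linarith
  · have hle : k.gcd (Fintype.card F - 1) ≤ Fintype.card F - 1 := Nat.gcd_le_right _ (by omega)
    have hb := even_semisimple_bound hx (by omega : _ ≤ Fintype.card F) hy
    have hxy := mul_gcd_mul_gcd_le hk (one_dvd k) (Nat.coprime_one_left _)
      (Nat.coprime_one_left _) hcop
    rw [one_mul] at hxy
    have hxy' : ((k.gcd (Fintype.card F - 1) : ℚ) * k.gcd (Fintype.card F + 1)) ≤ k := by
      exact_mod_cast hxy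
    have := mul_le_mul_of_nonneg_right hxy' (by positivity : (0 : ℚ) ≤ (Fintype.card F : ℚ) ^ 2)
    linarith

theorem le_localBreadth_psl2_of_even (h2 : (2 : F) = 0) :
    (Fintype.card F : ℚ) ^ 2 / 2 ≤ localBreadth (PSL2 F) 2 := by
  have hS := signCard_mul_ncard_solutionSet (F := F) 2
  rw [signCard_of_two_eq_zero h2, one_mul, one_mul] at hS
  rw [localBreadth, hS, Nat.cast_ofNat]
  have : (Fintype.card F : ℚ) ^ 2 ≤ (#{M : SL(2, F) | M ^ 2 = 1} : ℚ) := by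
    exact_mod_cast card_sq_le_of_two_eq_zero h2
  linarith

theorem two_dvd_card_psl2 (h2 : (2 : F) = 0) : 2 ∣ Nat.card (PSL2 F) := by
  have hc := card_sl2_eq F
  rw [signCard_of_two_eq_zero h2, one_mul] at hc
  rw [← hc]
  let M : SL(2, F) := ⟨!![1, 1; 0, 1], by simp [det_fin_two]⟩
  have hM : orderOf M = 2 := by
    refine orderOf_eq_prime (Subtype.ext ?_) fun h => ?_
    · change ((M ^ 2 : SL(2, F)) : Matrix (Fin 2) (Fin 2) F) = 1
      rw [Matrix.SpecialLinearGroup.coe_pow, sq]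
      change !![(1 : F), 1; 0, 1] * !![1, 1; 0, 1] = 1
      rw [mul_fin_two, one_fin_two]
      simp [one_add_one_eq_two, h2]
    · exact one_ne_zero (congrArg (fun N : SL(2, F) => N 0 1) h)
  exact hM.symm.dvd.trans (orderOf_dvd_natCard M)

end PSL2

theorem corollary3p1 {F : Type*} [Field F] [Finite F] (q : ℕ) (hq : Nat.card F = q) :
    (Odd q → 5 ≤ q →
      globalBreadth (PSL2 F) = (q : ℚ) * ((q : ℚ) - 1) / 2 - 2 ∧
      (q - 1) / 2 ∣ Nat.card (PSL2 F) ∧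
      localBreadth (PSL2 F) ((q - 1) / 2) = globalBreadth (PSL2 F)) ∧
    (∀ m : ℕ, 2 ≤ m → q = 2 ^ m →
      globalBreadth (PSL2 F) = (2 : ℚ) ^ (2 * m - 1) ∧
      2 ∣ Nat.card (PSL2 F) ∧
      localBreadth (PSL2 F) 2 = globalBreadth (PSL2 F)) := by
  classical
  have := Fintype.ofFinite F
  rw [Nat.card_eq_fintype_card] at hq
  have hq0 : ((q : ℕ) : F) = 0 := by rw [← hq, Nat.cast_card_eq_zero]
  constructor
  · rintro ⟨a, rfl⟩ h5
    have h2 : (2 : F) ≠ 0 := by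
      intro h2
      simp [h2] at hq0
    have ha : 2 ≤ a := by omega
    have hb : ((2 * a + 1 : ℕ) : ℚ) * (((2 * a + 1 : ℕ) : ℚ) - 1) / 2 - 2 =
        (2 * a + 1) * a - 2 := by
      push_cast
      ring
    have hd : (2 * a + 1 - 1) / 2 = a := by omega
    rw [hb, hd]
    refine globalBreadth_eq ?_ (fun k hk => localBreadth_psl2_le_of_odd hq ha h2 hk)
      (le_localBreadth_psl2_of_odd hq ha h2)
    have hdvd := card_sub_one_dvd_card_sl2 F
    rw [card_sl2_eq, signCard_of_two_ne_zero h2, hq, Nat.add_sub_cancel] at hdvd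
    exact Nat.dvd_of_mul_dvd_mul_left two_pos hdvd
  · rintro m hm rfl
    have h2 : (2 : F) = 0 := by
      push_cast at hq0
      exact pow_eq_zero_iff (by omega) |>.1 hq0
    have hb : (2 : ℚ) ^ (2 * m - 1) = (Fintype.card F : ℚ) ^ 2 / 2 := by
      rw [hq, eq_div_iff two_ne_zero, ← pow_succ, Nat.sub_add_cancel (by omega)]
      push_cast
      rw [← pow_mul, mul_comm]
    rw [hb]
    exact globalBreadth_eq (two_dvd_card_psl2 h2)
      (fun k hk => localBreadth_psl2_le_of_even h2 hk) (le_localBreadth_psl2_of_even h2)
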